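/- Let $d,m,n\ge 2$ be integers, let $\ell\ge 1$ be a divisor of $n$ with $\ell<n$, and let $\zeta\in\mathbb{C}$, $\zeta\ne 1$, be a $d$-th root of unity (not necessarily primitive). Define $a_i\in\mathbb{Z}[c]$ by $a_1=c$ and $a_{i+1}=a_i^d+c$, and for $k\ge 1$ let \[ G_{d,m,k}^{\zeta}(c)=\prod_{j\mid k}\big(a_{m+j-1}-\zeta a_{m-1}\big)^{\mu(k/j)}\cdot\begin{cases}\prod_{j\mid k}a_j^{-\mu(k/j)} & \text{if } k\mid m-1,\\ 1 & \text{if } k\nmid m-1,\end{cases} \] where $\mu$ is the Möbius function; this is a monic polynomial in $\mathbb{Z}[\zeta][c]$. Let $\alpha_0\in\mathbb{C}$ be a root of $G_{d,m,\ell}^{\zeta}$ and set $L=\mathbb{Q}(\alpha_0)$. For $f(z)=z^d+\alpha_0$, the point $f^m(0)$ is periodic, of exact period $\ell$; let $\lambda(\alpha_0)=(f^{\ell})'(f^m(0))$ be its multiplier. Suppose that $G_{d,m,n}^{\zeta}$ is irreducible over $\mathbb{Q}(\zeta)$, let $c_0\in\mathbb{C}$ be one of its roots, and set $K=\mathbb{Q}(c_0)$.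 Let $\Phi_{n/\ell}$ be the $(n/\ell)$-th cyclotomic polynomial. If $\Phi_{n/\ell}(\lambda(\alpha_0))$ is not a unit in $\mathcal{O}_L$, then $G_{d,m,\ell}^{\zeta}(c_0)$, which is an element of $\mathcal{O}_K$, is not a unit in $\mathcal{O}_K$. -/

import Mathlib

open Polynomial
open scoped IntermediateField NumberField

/-- The polynomials `a_i ∈ R[c]` giving the critical orbit of `z ↦ z ^ d + c`:
`a_0 = 0` and `a_{i+1} = a_i ^ d + c`, so that `a_1 = c` (for `d ≥ 1`).
The variable `c` is `X`. -/
noncomputable def critOrbit (R : Type*) [CommRing R] (d : ℕ) : ℕ → R[X]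
  | 0 => 0
  | i + 1 => critOrbit R d i ^ d + X

/-- The rational function in `c` given by the Möbius product
`∏_{k ∣ n} (a_{m+k-1} - ζ a_{m-1}) ^ μ(n/k)`, multiplied by
`∏_{k ∣ n} a_k ^ (-μ(n/k))` when `n ∣ m - 1`. -/
noncomputable def misiurewiczRatFunc {F : Type*} [Field F] (d m n : ℕ) (ζ : F) : RatFunc F :=
  (∏ k ∈ n.divisors,
      algebraMap F[X] (RatFunc F)
        (critOrbit F d (m + k - 1) - C ζ * critOrbit F d (m - 1)) ^
          ArithmeticFunction.moebius (n / k)) *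
    (if n ∣ m - 1 then
      ∏ k ∈ n.divisors,
        algebraMap F[X] (RatFunc F) (critOrbit F d k) ^ (-ArithmeticFunction.moebius (n / k))
    else 1)

/-- The Misiurewicz polynomial `G_{d,m,n}^ζ`. For `d, m ≥ 2`, `n ≥ 1` and `ζ ≠ 1` a `d`-th root
of unity in characteristic zero, the Möbius product is a polynomial in `c`,
and it is then equal to its own numerator. -/
noncomputable def misiurewicz {F : Type*} [Field F] (d m n : ℕ) (ζ : F) : F[X] :=
  (misiurewiczRatFunc d m n ζ).num

/-- The multiplier `(f^p)'(x)` of a periodic point `x ∈ ℂ` of exact period `p` of `f`. -/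
noncomputable def multiplier (f : ℂ → ℂ) (x : ℂ) : ℂ :=
  deriv f^[Function.minimalPeriod f x] x

/-- The multiplier of the periodic cycle which the critical orbit of `f(z) = z ^ d + c` enters,
the critical point `0` having tail length `m`: the multiplier of the point `f^m(0)`. -/
noncomputable def cycleMultiplier (d m : ℕ) (c : ℂ) : ℂ :=
  multiplier (fun z => z ^ d + c) ((fun z => z ^ d + c)^[m] 0)

/-! Write `f(z) = z ^ d + b` with `b = α₀`, and `x = ζ a_{m-1}(b)`. Since `ζ ^ d = 1`, `f(x) =
a_m(b)`, so `a_{m+k-1} - ζ a_{m-1}` takes the value `f^k(x) - x` at `b`; the root condition on `b`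
says that `x` has exact period `ℓ`, and the multiplier `λ` is `(f^ℓ)'(x)`. A non-unit `Φ_{n/ℓ}(λ)`
gives a valuation `v` of `ℂ`, at most 1 on algebraic integers, with `v(Φ_{n/ℓ}(λ)) < 1`. The core
claim is `v(G_n(b)) < 1` (`moebiusProd_leadingCoeffAt`). Factors of the Möbius product may vanish at
`b`, so each is replaced by its leading coefficient there. Up to valuation, the `k`-th one depends
only on `gcd(k, ℓ)`, times `1 + λ + ... + λ ^ (k/ℓ - 1)` when `ℓ ∣ k`. Möbius inversion kills the
first part and turns the second into `Φ_{n/ℓ}(λ)`. The correction factors `a_k` have valuation 1. As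
`G_n` is monic, some root `c` satisfies `v(b - c) < 1`, whence `v(G_ℓ(c)) < 1`. Irreducibility makes
`c` conjugate to `c₀`, so `G_ℓ(c₀)` is not a unit. -/

/-! ### Multiplicative Möbius inversion. -/

section Moebius

variable {Γ : Type*} [CommGroupWithZero Γ]

lemma prod_zpow_moebius_eq {g h : ℕ → Γ} (hh : ∀ t, 0 < t → h t ≠ 0)
    (hg : ∀ j, 0 < j → g j = ∏ t ∈ j.divisors, h t) {n : ℕ} (hn : 0 < n) :
    ∏ j ∈ n.divisors, g j ^ ArithmeticFunction.moebius (n / j) = h n := by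
  have hg0 : ∀ j, 0 < j → g j ≠ 0 := fun j hj => by
    rw [hg j hj]
    exact Finset.prod_ne_zero_iff.2 fun t ht => hh t (Nat.pos_of_mem_divisors ht)
  have := (ArithmeticFunction.prod_eq_iff_prod_pow_moebius_eq_of_nonzero hh hg0).1
    (fun j hj => (hg j hj).symm) n hn
  rw [← this]
  exact (Nat.prod_divisorsAntidiagonal' (fun a b => g b ^ ArithmeticFunction.moebius a)).symm

lemma exists_prod_divisors_eq {g : ℕ → Γ} (hg : ∀ j, 0 < j → g j ≠ 0) :
    ∃ h : ℕ → Γ, (∀ t, 0 < t → h t ≠ 0) ∧ ∀ j, 0 < j → g j = ∏ t ∈ j.divisors, h t := by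
  have h0 : ∀ n, 0 < n →
      ∏ x ∈ n.divisorsAntidiagonal, g x.snd ^ ArithmeticFunction.moebius x.fst ≠ 0 := by
    intro n hn
    refine Finset.prod_ne_zero_iff.2 fun x hx => zpow_ne_zero _ (hg _ ?_)
    rw [Nat.mem_divisorsAntidiagonal] at hx
    exact Nat.pos_of_ne_zero fun h => hx.2 (by rw [← hx.1, h, mul_zero])
  refine ⟨_, h0, fun j hj => ?_⟩
  exact ((ArithmeticFunction.prod_eq_iff_prod_pow_moebius_eq_of_nonzero h0 hg).2
    (fun _ _ => rfl) j hj).symm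

/-- If `g` is the divisor product of `h`, then `j ↦ g (gcd j l)` is the divisor product of `h` cut
off to the divisors of `l`. Inversion returns its value at `n`, which does not divide `l`. -/
lemma prod_gcd_zpow_moebius_eq_one {g : ℕ → Γ} (hg : ∀ j, 0 < j → g j ≠ 0) {n l : ℕ}
    (hn : 0 < n) (hl : 0 < l) (hln : l < n) :
    ∏ j ∈ n.divisors, g (j.gcd l) ^ ArithmeticFunction.moebius (n / j) = 1 := by
  obtain ⟨h, h0, hgh⟩ := exists_prod_divisors_eq hg
  rw [prod_zpow_moebius_eq (g := fun j => g (j.gcd l)) (h := fun t => if t ∣ l then h t else 1)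
    _ _ hn, if_neg (Nat.not_dvd_of_pos_of_lt hl hln)]
  · intro t ht
    split_ifs
    exacts [h0 t ht, one_ne_zero]
  · intro j hj
    rw [hgh _ (Nat.gcd_pos_of_pos_right _ hl), ← Finset.prod_filter]
    refine Finset.prod_congr ?_ fun _ _ => rfl
    ext t
    simp only [Nat.mem_divisors, Finset.mem_filter, Nat.dvd_gcd_iff]
    have : j.gcd l ≠ 0 := (Nat.gcd_pos_of_pos_right _ hl).ne'
    have := hj.ne'
    tauto

lemma prod_ite_dvd_zpow_moebius {r : Γ} (hr : r ≠ 0) (p : ℕ) {n : ℕ} (hn : 0 < n) :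
    ∏ j ∈ n.divisors, (if p ∣ j then r else 1) ^ ArithmeticFunction.moebius (n / j) =
      if n = p then r else 1 := by
  refine prod_zpow_moebius_eq (g := fun j => if p ∣ j then r else 1)
    (h := fun t => if t = p then r else 1) ?_ ?_ hn
  · intro t _
    split_ifs
    exacts [hr, one_ne_zero]
  · intro j hj
    rw [Finset.prod_ite_eq']
    simp [hj.ne']

/-- The geometric sum of length `q` is the product of `Φ_t(x)` over `t ∣ q`, `t ≠ 1`; reindexing by
`t ↦ l * t` makes it a divisor product. Inversion needs nonzero factors, which `hx` provides. -/
lemma prod_geom_sum_zpow_moebius {K : Type*} [Field K] {x : K}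
    (hx : ∀ q, 0 < q → ∑ i ∈ Finset.range q, x ^ i ≠ 0) {n l : ℕ} (hn : 0 < n) (hln : l ∣ n)
    (hlt : l < n) :
    ∏ j ∈ n.divisors, (if l ∣ j then ∑ i ∈ Finset.range (j / l), x ^ i else 1) ^
      ArithmeticFunction.moebius (n / j) = (cyclotomic (n / l) K).eval x := by
  have hl : 0 < l := Nat.pos_of_dvd_of_pos hln hn
  have hprod : ∀ q, 0 < q → ∑ i ∈ Finset.range q, x ^ i =
      ∏ t ∈ q.divisors.erase 1, (cyclotomic t K).eval x := by
    intro q hq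
    rw [← eval_prod, prod_cyclotomic_eq_geom_sum hq, eval_geom_sum]
  have hc : ∀ t, 1 < t → (cyclotomic t K).eval x ≠ 0 := by
    intro t ht h0
    refine hx t (by omega) ?_
    rw [hprod t (by omega)]
    exact Finset.prod_eq_zero (by simp; omega) h0
  have key := prod_zpow_moebius_eq
    (g := fun j => if l ∣ j then ∑ i ∈ Finset.range (j / l), x ^ i else 1)
    (h := fun t => if l ∣ t ∧ t ≠ l then (cyclotomic (t / l) K).eval x else 1) ?_ ?_ hn
  · rw [if_pos ⟨hln, hlt.ne'⟩] at key
    exact key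
  · intro t ht
    split_ifs with h
    · refine hc _ ?_
      obtain ⟨⟨s, rfl⟩, h⟩ := h
      rw [Nat.mul_div_cancel_left _ hl]
      rcases s with _ | _ | s
      · simp at ht
      · simp at h
      · omega
    · exact one_ne_zero
  · intro j hj
    rw [← Finset.prod_filter]
    split_ifs with h
    · obtain ⟨q, rfl⟩ := h
      rw [Nat.mul_div_cancel_left _ hl, hprod q (Nat.pos_of_mul_pos_left hj)]
      refine Finset.prod_bij' (fun t _ => l * t) (fun t _ => t / l) ?_ ?_ ?_ ?_ ?_
      · intro t ht
        simp only [Finset.mem_erase, Nat.mem_divisors, Finset.mem_filter] at ht ⊢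
        refine ⟨⟨Nat.mul_dvd_mul_left _ ht.2.1, hj.ne'⟩, dvd_mul_right _ _, fun h => ht.1 ?_⟩
        exact Nat.eq_of_mul_eq_mul_left hl (h.trans (mul_one l).symm)
      · intro t ht
        simp only [Finset.mem_erase, Nat.mem_divisors, Finset.mem_filter] at ht ⊢
        obtain ⟨⟨h1, h2⟩, ⟨s, rfl⟩, h4⟩ := ht
        rw [Nat.mul_div_cancel_left _ hl]
        refine ⟨fun h => h4 (by rw [h, mul_one]), Nat.dvd_of_mul_dvd_mul_left hl h1, ?_⟩
        exact (Nat.pos_of_mul_pos_left hj).ne'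
      · intro t _
        exact Nat.mul_div_cancel_left _ hl
      · intro t ht
        simp only [Finset.mem_filter] at ht
        exact Nat.mul_div_cancel' ht.2.1
      · intro t _
        rw [Nat.mul_div_cancel_left _ hl]
    · symm
      refine Finset.prod_eq_one fun t ht => ?_
      simp only [Nat.mem_divisors, Finset.mem_filter] at ht
      exact absurd (ht.2.1.trans ht.1.1) h

end Moebius

/-! ### Critical orbit polynomials and their differences. -/

section CriticalOrbit

variable {R S : Type*} [CommRing R] [CommRing S]

lemma map_critOrbit (g : R →+* S) (d i : ℕ) :
    (critOrbit R d i).map g = critOrbit S d i := by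
  induction i with
  | zero => simp [critOrbit]
  | succ i ih => simp [critOrbit, ih]

lemma critOrbit_eq_iterate (d i : ℕ) :
    critOrbit R d i = (fun P => P ^ d + X)^[i] 0 := by
  induction i with
  | zero => rfl
  | succ i ih => rw [Function.iterate_succ_apply', critOrbit, ih]

lemma critOrbit_add (d i k : ℕ) :
    critOrbit R d (i + k) = (fun P => P ^ d + X)^[k] (critOrbit R d i) := by
  rw [critOrbit_eq_iterate, critOrbit_eq_iterate, ← Function.iterate_add_apply, add_comm]

lemma eval_iterate (d : ℕ) (b : R) (P : R[X]) (k : ℕ) :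
    ((fun P => P ^ d + X)^[k] P).eval b = (fun z => z ^ d + b)^[k] (P.eval b) := by
  induction k with
  | zero => rfl
  | succ k ih => simp [Function.iterate_succ_apply', ih]

lemma eval_critOrbit (d : ℕ) (b : R) (i : ℕ) :
    (critOrbit R d i).eval b = (fun z => z ^ d + b)^[i] 0 := by
  rw [critOrbit_eq_iterate, eval_iterate, eval_zero]

lemma critOrbit_monic_natDegree [Nontrivial R] {d : ℕ} (hd : 2 ≤ d) (i : ℕ) :
    (critOrbit R d (i + 1)).Monic ∧ (critOrbit R d (i + 1)).natDegree = d ^ i := by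
  induction i with
  | zero => simp [critOrbit, show d ≠ 0 by omega, monic_X]
  | succ i ih =>
    have hm : (critOrbit R d (i + 1) ^ d).Monic := ih.1.pow d
    have hdeg : (critOrbit R d (i + 1) ^ d).natDegree = d ^ (i + 1) := by
      rw [ih.1.natDegree_pow, ih.2, pow_succ']
    have hlt : (X : R[X]).natDegree < (critOrbit R d (i + 1) ^ d).natDegree := by
      rw [hdeg, natDegree_X]
      exact Nat.one_lt_pow (by omega) (by omega)
    rw [critOrbit]
    exact ⟨hm.add_of_left (degree_lt_degree hlt),
      (natDegree_add_eq_left_of_natDegree_lt hlt).trans hdeg⟩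

lemma critOrbit_monic [Nontrivial R] {d : ℕ} (hd : 2 ≤ d) {i : ℕ} (hi : 0 < i) :
    (critOrbit R d i).Monic := by
  obtain ⟨i, rfl⟩ := Nat.exists_eq_succ_of_ne_zero hi.ne'
  exact (critOrbit_monic_natDegree hd i).1

/-- The polynomial `a_{m+k-1} - ζ a_{m-1}`. -/
noncomputable def critDiff (d m : ℕ) (z : R) (k : ℕ) : R[X] :=
  critOrbit R d (m + k - 1) - C z * critOrbit R d (m - 1)

lemma map_critDiff (g : R →+* S) (d m : ℕ) (z : R) (k : ℕ) :
    (critDiff d m z k).map g = critDiff d m (g z) k := by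
  simp [critDiff, map_critOrbit]

lemma critDiff_monic [Nontrivial R] {d m : ℕ} (hd : 2 ≤ d) (hm : 2 ≤ m) (z : R) {k : ℕ}
    (hk : 0 < k) : (critDiff d m z k).Monic := by
  obtain ⟨m, rfl⟩ := Nat.exists_eq_add_of_le hm
  obtain ⟨k, rfl⟩ := Nat.exists_eq_succ_of_ne_zero hk.ne'
  have h1 := critOrbit_monic_natDegree (R := R) hd (m + k + 1)
  have h2 := critOrbit_monic_natDegree (R := R) hd m
  rw [critDiff, show 2 + m + k.succ - 1 = m + k + 1 + 1 by omega, show 2 + m - 1 = m + 1 by omega]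
  refine h1.1.sub_of_left (degree_lt_degree ?_)
  refine (natDegree_C_mul_le _ _).trans_lt ?_
  rw [h1.2, h2.2]
  exact Nat.pow_lt_pow_right (by omega) (by omega)

/-- The derivative `(f^k)'(z)` of the `k`-th iterate of `f(z) = z ^ d + c`. -/
def iterateDeriv (d : ℕ) (c z : R) (k : ℕ) : R :=
  ∏ i ∈ Finset.range k, (d * ((fun w => w ^ d + c)^[i] z) ^ (d - 1))

/-- The chain rule in difference-quotient form: where `P` and `Q` agree, the quotient specialises to
the derivative of the iterate. -/
lemma exists_iterate_sub_eq_mul (d : ℕ) {b : R} {P Q : R[X]} (h : P.eval b = Q.eval b) (k : ℕ) :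
    ∃ S : R[X], (fun P => P ^ d + X)^[k] P - (fun P => P ^ d + X)^[k] Q = (P - Q) * S ∧
      S.eval b = iterateDeriv d b (Q.eval b) k := by
  induction k with
  | zero => exact ⟨1, by simp, by simp [iterateDeriv]⟩
  | succ k ih =>
    obtain ⟨S, hS, hSb⟩ := ih
    set P' := (fun P => P ^ d + X)^[k] P
    set Q' := (fun P => P ^ d + X)^[k] Q
    refine ⟨S * ∑ i ∈ Finset.range d, P' ^ i * Q' ^ (d - 1 - i), ?_, ?_⟩
    · rw [Function.iterate_succ_apply', Function.iterate_succ_apply', ← mul_assoc, ← hS,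
        mul_comm (P' - Q'), (Commute.all P' Q').geom_sum₂_mul]
      ring
    · have hPQ : P'.eval b = Q'.eval b := by simp only [P', Q', eval_iterate, h]
      have hQ : Q'.eval b = (fun w => w ^ d + b)^[k] (Q.eval b) := eval_iterate _ _ _ _
      rw [eval_mul, hSb, iterateDeriv, iterateDeriv, Finset.prod_range_succ, eval_finsetSum,
        ← hQ]
      congr 1
      have : ∀ i ∈ Finset.range d, (P' ^ i * Q' ^ (d - 1 - i)).eval b = Q'.eval b ^ (d - 1) := by
        intro i hi
        rw [Finset.mem_range] at hi
        rw [eval_mul, eval_pow, eval_pow, hPQ, ← pow_add]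
        congr 1
        omega
      rw [Finset.sum_congr rfl this]
      simp

lemma critDiff_eq_iterate_sub {d m : ℕ} (hm : 2 ≤ m) {z : R} (hz : z ^ d = 1) {k : ℕ}
    (hk : 0 < k) : critDiff d m z k =
      (fun P => P ^ d + X)^[k] (C z * critOrbit R d (m - 1)) - C z * critOrbit R d (m - 1) := by
  obtain ⟨k, rfl⟩ := Nat.exists_eq_succ_of_ne_zero hk.ne'
  rw [critDiff, show m + k.succ - 1 = m - 1 + 1 + k by omega, critOrbit_add,
    Function.iterate_succ_apply, critOrbit, mul_pow, ← C_pow, hz, C_1, one_mul]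

lemma eval_critDiff {d m : ℕ} (hm : 2 ≤ m) {z : R} (hz : z ^ d = 1) (b : R) {k : ℕ}
    (hk : 0 < k) : (critDiff d m z k).eval b =
      (fun w => w ^ d + b)^[k] (z * (critOrbit R d (m - 1)).eval b) -
        z * (critOrbit R d (m - 1)).eval b := by
  rw [critDiff_eq_iterate_sub hm hz hk, eval_sub, eval_iterate, eval_mul, eval_C]

/-- With `w = z a_{m-1}`, split `f^{l(q+1)}(w) - w` as `(f^l(f^{lq}(w)) - f^l(w)) + (f^l(w) - w)`.
At `b` the quotient obeys `H ↦ 1 + λ H`, which builds the geometric sum. -/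
lemma exists_critDiff_mul_eq {d m : ℕ} (hm : 2 ≤ m) {z : R} (hz : z ^ d = 1) {b : R} {l : ℕ}
    (hl : 0 < l) (hb : (critDiff d m z l).eval b = 0) {q : ℕ} (hq : 0 < q) :
    ∃ H : R[X], critDiff d m z (l * q) = critDiff d m z l * H ∧
      H.eval b = ∑ i ∈ Finset.range q,
        iterateDeriv d b (z * (critOrbit R d (m - 1)).eval b) l ^ i := by
  set w := C z * critOrbit R d (m - 1) with hw
  have hwb : w.eval b = z * (critOrbit R d (m - 1)).eval b := by simp [hw]
  induction q, hq using Nat.le_induction with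
  | base => exact ⟨1, by simp, by simp⟩
  | succ q hq ih =>
    obtain ⟨H, hH, hHb⟩ := ih
    have h0 : (critDiff d m z (l * q)).eval b = 0 := by rw [hH, eval_mul, hb, zero_mul]
    have hlq : 0 < l * q := Nat.mul_pos hl hq
    rw [critDiff_eq_iterate_sub hm hz hlq, eval_sub, sub_eq_zero] at h0
    obtain ⟨S, hS, hSb⟩ := exists_iterate_sub_eq_mul d h0 l
    refine ⟨1 + H * S, ?_, ?_⟩
    · rw [← Function.iterate_add_apply, ← hw, ← critDiff_eq_iterate_sub hm hz hlq, hH] at hS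
      have h1 := critDiff_eq_iterate_sub hm hz hl
      have h2 := critDiff_eq_iterate_sub (m := m) hm hz (k := l * (q + 1)) (by positivity)
      rw [mul_add_one, add_comm (l * q), ← hw] at h2
      rw [mul_add_one, add_comm (l * q), h2]
      rw [← hw] at h1
      rw [mul_add, mul_one, ← mul_assoc, ← hS, h1]
      ring
    · rw [eval_add, eval_one, eval_mul, hHb, hSb, ← hw, hwb, geom_sum_succ]
      ring

end CriticalOrbit

/-! ### Algebraic integers and nonvanishing modulo `d`. -/

section Integrality

/-- Otherwise `-1/d` would be an algebraic integer. -/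
lemma one_add_natCast_mul_ne_zero {d : ℕ} (hd : 2 ≤ d) {w : ℂ} (hw : IsIntegral ℤ w) :
    1 + (d : ℂ) * w ≠ 0 := by
  intro h
  have hd0 : (d : ℂ) ≠ 0 := by exact_mod_cast (by omega : d ≠ 0)
  have hwq : algebraMap ℚ ℂ (-(d : ℚ)⁻¹) = w := by
    have : w = -(d : ℂ)⁻¹ := by
      field_simp
      linear_combination h
    simp [this]
  rw [← hwq, isIntegral_algebraMap_iff (algebraMap ℚ ℂ).injective,
    IsIntegrallyClosed.isIntegral_iff] at hw
  obtain ⟨y, hy⟩ := hw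
  have hd0' : (d : ℚ) ≠ 0 := by exact_mod_cast (by omega : d ≠ 0)
  have h1 : (y : ℚ) * d = -1 := by
    rw [eq_intCast] at hy
    rw [hy]
    field_simp
  have h2 : (d : ℤ) ∣ 1 := ⟨-y, by
    have : y * (d : ℤ) = -1 := by exact_mod_cast h1
    linarith⟩
  have := Int.le_of_dvd one_pos h2
  omega

lemma isIntegral_iterate {d : ℕ} {c z : ℂ} (hc : IsIntegral ℤ c) (hz : IsIntegral ℤ z) (k : ℕ) :
    IsIntegral ℤ ((fun w => w ^ d + c)^[k] z) := by
  induction k with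
  | zero => exact hz
  | succ k ih =>
    rw [Function.iterate_succ_apply']
    exact (ih.pow d).add hc

lemma isIntegral_eval_critOrbit {d : ℕ} {c : ℂ} (hc : IsIntegral ℤ c) (k : ℕ) :
    IsIntegral ℤ ((critOrbit ℂ d k).eval c) := by
  rw [eval_critOrbit]
  exact isIntegral_iterate hc isIntegral_zero k

lemma exists_iterateDeriv_eq {d : ℕ} {c z : ℂ} (hc : IsIntegral ℤ c) (hz : IsIntegral ℤ z)
    {k : ℕ} (hk : 0 < k) : ∃ w, IsIntegral ℤ w ∧ iterateDeriv d c z k = d * w := by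
  obtain ⟨k, rfl⟩ := Nat.exists_eq_succ_of_ne_zero hk.ne'
  refine ⟨_, ?_, (Finset.prod_range_succ' _ _).trans ((mul_left_comm _ _ _))⟩
  refine IsIntegral.mul (IsIntegral.prod _ fun i _ => ?_) ((isIntegral_iterate hc hz _).pow _)
  exact (map_natCast (algebraMap ℤ ℂ) d ▸ isIntegral_algebraMap).mul
    ((isIntegral_iterate hc hz _).pow _)

/-- The derivative is `d` times an algebraic integer, so the sum is 1 modulo `d`. -/
lemma geom_sum_iterateDeriv_ne_zero {d : ℕ} (hd : 2 ≤ d) {c z : ℂ} (hc : IsIntegral ℤ c)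
    (hz : IsIntegral ℤ z) {k : ℕ} (hk : 0 < k) {q : ℕ} (hq : 0 < q) :
    ∑ i ∈ Finset.range q, iterateDeriv d c z k ^ i ≠ 0 := by
  obtain ⟨w, hw, h⟩ := exists_iterateDeriv_eq (d := d) hc hz hk
  obtain ⟨q, rfl⟩ := Nat.exists_eq_succ_of_ne_zero hq.ne'
  have hint : IsIntegral ℤ (iterateDeriv d c z k) :=
    h ▸ (map_natCast (algebraMap ℤ ℂ) d ▸ isIntegral_algebraMap).mul hw
  rw [geom_sum_succ, add_comm]
  nth_rw 1 [h]
  rw [mul_assoc]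
  exact one_add_natCast_mul_ne_zero hd (hw.mul (IsIntegral.sum _ fun i _ => hint.pow i))

lemma isIntegral_of_eval_critDiff_eq_zero {d m : ℕ} (hd : 2 ≤ d) (hm : 2 ≤ m) {z : ℂ}
    (hz : IsIntegral ℤ z) {k : ℕ} (hk : 0 < k) {b : ℂ} (hb : (critDiff d m z k).eval b = 0) :
    IsIntegral ℤ b := by
  have : IsIntegral (integralClosure ℤ ℂ) b := by
    refine ⟨critDiff d m ⟨z, hz⟩ k, critDiff_monic hd hm _ hk, ?_⟩
    rw [eval₂_eq_eval_map, map_critDiff]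
    exact hb
  exact isIntegral_trans b this

lemma isIntegral_of_eval_critOrbit_eq_zero {d : ℕ} (hd : 2 ≤ d) {k : ℕ} (hk : 0 < k) {b : ℂ}
    (hb : (critOrbit ℂ d k).eval b = 0) : IsIntegral ℤ b :=
  ⟨critOrbit ℤ d k, critOrbit_monic hd hk, by rwa [eval₂_eq_eval_map, map_critOrbit]⟩

/-- Differentiating `a_{k+1} = a_k ^ d + c` gives a value that is 1 modulo `d`. -/
lemma eval_derivative_critOrbit_ne_zero {d : ℕ} (hd : 2 ≤ d) {b : ℂ} (hb : IsIntegral ℤ b)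
    {k : ℕ} (hk : 0 < k) : (derivative (critOrbit ℂ d k)).eval b ≠ 0 := by
  obtain ⟨k, rfl⟩ := Nat.exists_eq_succ_of_ne_zero hk.ne'
  have hint : IsIntegral ℤ ((derivative (critOrbit ℂ d k)).eval b) := by
    rw [← map_critOrbit (algebraMap ℤ ℂ), derivative_map, eval_map_algebraMap]
    exact adjoin_le_integralClosure hb (aeval_mem_adjoin_singleton ℤ b)
  rw [critOrbit, derivative_add, derivative_X, derivative_pow, eval_add, eval_one, add_comm,
    eval_mul, eval_mul, eval_C, mul_assoc, eval_pow]
  exact one_add_natCast_mul_ne_zero hd (((isIntegral_eval_critOrbit hb k).pow _).mul hint)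

end Integrality

/-! ### Orders of vanishing, encoded as `2 ^ ord` to pass multiplicatively through the Möbius
product. -/

section Order

lemma rootMultiplicity_eq_one_of_derivative {P : ℂ[X]} {b : ℂ} (h0 : P.eval b = 0)
    (h1 : P.derivative.eval b ≠ 0) : P.rootMultiplicity b = 1 := by
  have hP : P ≠ 0 := by rintro rfl; simp at h1
  have h2 : 0 < P.rootMultiplicity b := (rootMultiplicity_pos hP).2 h0
  have h3 : ¬ 1 < P.rootMultiplicity b := fun h =>
    h1 ((one_lt_rootMultiplicity_iff_isRoot hP).1 h).2
  omega

open Classical in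
/-- The multiplicative map `P ↦ 2 ^ ord_b(P)`. -/
noncomputable def twoPowOrder (b : ℂ) : ℂ[X] →*₀ ℚ where
  toFun P := if P = 0 then 0 else 2 ^ P.rootMultiplicity b
  map_zero' := by simp
  map_one' := by simp [← C_1, rootMultiplicity_C, -map_one]
  map_mul' P Q := by
    by_cases hP : P = 0
    · simp [hP]
    by_cases hQ : Q = 0
    · simp [hQ]
    simp [hP, hQ, rootMultiplicity_mul (mul_ne_zero hP hQ), pow_add]

lemma twoPowOrder_apply (b : ℂ) {P : ℂ[X]} (hP : P ≠ 0) :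
    twoPowOrder b P = 2 ^ P.rootMultiplicity b := if_neg hP

lemma twoPowOrder_eq_one {b : ℂ} {P : ℂ[X]} (h : P.eval b ≠ 0) : twoPowOrder b P = 1 := by
  have hP : P ≠ 0 := by rintro rfl; simp at h
  rw [twoPowOrder_apply _ hP, rootMultiplicity_eq_zero h, pow_zero]

lemma one_lt_twoPowOrder {b : ℂ} {P : ℂ[X]} (hP : P ≠ 0) (h : P.eval b = 0) :
    1 < twoPowOrder b P := by
  rw [twoPowOrder_apply _ hP]
  exact one_lt_pow₀ one_lt_two ((rootMultiplicity_pos hP).2 h).ne'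

/-- The Möbius product defining `misiurewiczRatFunc`, transported along a multiplicative map. -/
noncomputable def moebiusProd {F Γ : Type*} [Field F] [CommGroupWithZero Γ] (χ : F[X] →*₀ Γ)
    (d m n : ℕ) (z : F) : Γ :=
  (∏ k ∈ n.divisors, χ (critDiff d m z k) ^ ArithmeticFunction.moebius (n / k)) *
    (if n ∣ m - 1 then
      ∏ k ∈ n.divisors, χ (critOrbit F d k) ^ (-ArithmeticFunction.moebius (n / k))
    else 1)

variable {d m n : ℕ} {z b : ℂ}

lemma eval_critOrbit_eq_zero_iff (k : ℕ) : (critOrbit ℂ d k).eval b = 0 ↔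
    Function.minimalPeriod (fun w => w ^ d + b) 0 ∣ k := by
  rw [eval_critOrbit, ← Function.isPeriodicPt_iff_minimalPeriod_dvd]
  rfl

lemma eval_critDiff_eq_zero_iff (hm : 2 ≤ m) (hz : z ^ d = 1) {k : ℕ} (hk : 0 < k) :
    (critDiff d m z k).eval b = 0 ↔ Function.minimalPeriod (fun w => w ^ d + b)
      (z * (critOrbit ℂ d (m - 1)).eval b) ∣ k := by
  rw [eval_critDiff hm hz b hk, sub_eq_zero, ← Function.isPeriodicPt_iff_minimalPeriod_dvd]
  rfl

lemma isIntegral_of_pow_eq_one (hd : 2 ≤ d) (hz : z ^ d = 1) : IsIntegral ℤ z :=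
  ⟨X ^ d - 1, monic_X_pow_sub_C 1 (by omega), by simp [hz]⟩

lemma twoPowOrder_critOrbit (hd : 2 ≤ d) {k : ℕ} (hk : 0 < k) :
    twoPowOrder b (critOrbit ℂ d k) =
      if Function.minimalPeriod (fun w => w ^ d + b) 0 ∣ k then 2 else 1 := by
  split_ifs with h
  · rw [← eval_critOrbit_eq_zero_iff] at h
    rw [twoPowOrder_apply _ (critOrbit_monic hd hk).ne_zero,
      rootMultiplicity_eq_one_of_derivative h (eval_derivative_critOrbit_ne_zero hd
        (isIntegral_of_eval_critOrbit_eq_zero hd hk h) hk), pow_one]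
  · rw [← eval_critOrbit_eq_zero_iff] at h
    exact twoPowOrder_eq_one h

lemma twoPowOrder_critDiff_of_eq_zero (hd : 2 ≤ d) (hm : 2 ≤ m) (hz1 : z ≠ 1)
    (hb : (critOrbit ℂ d (m - 1)).eval b = 0) {k : ℕ} (hk : 0 < k) :
    twoPowOrder b (critDiff d m z k) =
      if Function.minimalPeriod (fun w => w ^ d + b) 0 ∣ k then 2 else 1 := by
  have hev : (critDiff d m z k).eval b = (critOrbit ℂ d (m + k - 1)).eval b := by
    simp [critDiff, hb]
  have hdvd : (critDiff d m z k).eval b = 0 ↔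
      Function.minimalPeriod (fun w => w ^ d + b) 0 ∣ k := by
    rw [hev, eval_critOrbit_eq_zero_iff, show m + k - 1 = m - 1 + k by omega]
    exact (Nat.dvd_add_iff_right ((eval_critOrbit_eq_zero_iff _).1 hb)).symm
  split_ifs with h
  · have hk0 : (critOrbit ℂ d k).eval b = 0 := (eval_critOrbit_eq_zero_iff k).2 h
    rw [twoPowOrder_apply _ (critDiff_monic hd hm _ hk).ne_zero,
      rootMultiplicity_eq_one_of_derivative (hdvd.2 h), pow_one]
    -- Here `S` specialises to the derivative of `f^{m-1}` at the critical point 0, which vanishes.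
    -- So only `(1 - z) a_{m-1}` contributes to the derivative at `b`.
    obtain ⟨S, hS, hSb⟩ := exists_iterate_sub_eq_mul (R := ℂ) d (b := b) (P := critOrbit ℂ d k)
      (Q := 0) (by rw [hk0, eval_zero]) (m - 1)
    have hS0 : S.eval b = 0 := by
      rw [hSb, iterateDeriv]
      refine Finset.prod_eq_zero (i := 0) (Finset.mem_range.2 (by omega)) ?_
      simp [show d - 1 ≠ 0 by omega]
    rw [← critOrbit_add, ← critOrbit_eq_iterate, sub_zero] at hS
    have heq : critDiff d m z k = critOrbit ℂ d k * S + C (1 - z) * critOrbit ℂ d (m - 1) := by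
      rw [← hS, critDiff, show m + k - 1 = k + (m - 1) by omega, C_sub, C_1]
      ring
    rw [heq]
    simp only [derivative_add, derivative_mul, derivative_C, eval_add, eval_mul, hS0, hk0, eval_C,
      zero_mul, mul_zero, add_zero, zero_add]
    exact mul_ne_zero (sub_ne_zero.2 hz1.symm) (eval_derivative_critOrbit_ne_zero hd
        (isIntegral_of_eval_critOrbit_eq_zero hd hk hk0) (by omega))
  · exact twoPowOrder_eq_one (mt hdvd.1 h)

lemma twoPowOrder_critDiff_mul (hd : 2 ≤ d) (hm : 2 ≤ m) (hz : z ^ d = 1) {l : ℕ} (hl : 0 < l)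
    (hb : (critDiff d m z l).eval b = 0) {q : ℕ} (hq : 0 < q) :
    twoPowOrder b (critDiff d m z (l * q)) = twoPowOrder b (critDiff d m z l) := by
  obtain ⟨H, hH, hHb⟩ := exists_critDiff_mul_eq hm hz hl hb hq
  have hzi := isIntegral_of_pow_eq_one hd hz
  have hbi := isIntegral_of_eval_critDiff_eq_zero hd hm hzi hl hb
  rw [hH, map_mul, twoPowOrder_eq_one (P := H), mul_one]
  rw [hHb]
  exact geom_sum_iterateDeriv_ne_zero hd hbi (hzi.mul (isIntegral_eval_critOrbit hbi _)) hl hq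

/-- If `a_{m-1}(b) = 0`, all zeros at `b` are simple and governed by the period of 0, and the
correction factor cancels them. Otherwise the order of the `k`-th factor is constant on the
multiples of the period `p` of `z a_{m-1}(b)`, so inversion leaves it only for `n = p`. -/
lemma moebiusProd_twoPowOrder (hd : 2 ≤ d) (hm : 2 ≤ m) (hn : 0 < n) (hz : z ^ d = 1)
    (hz1 : z ≠ 1) (b : ℂ) :
    moebiusProd (twoPowOrder b) d m n z = 1 ∨
      (1 < moebiusProd (twoPowOrder b) d m n z ∧ (critOrbit ℂ d (m - 1)).eval b ≠ 0 ∧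
        ∀ k, 0 < k → ((critDiff d m z k).eval b = 0 ↔ n ∣ k)) := by
  have hdp : ∀ {k}, k ∈ n.divisors → 0 < k := fun h => Nat.pos_of_mem_divisors h
  by_cases hb : (critOrbit ℂ d (m - 1)).eval b = 0
  · left
    have hdvd := (eval_critOrbit_eq_zero_iff _).1 hb
    set p := Function.minimalPeriod (fun w => w ^ d + b) 0
    have h1 : ∏ k ∈ n.divisors,
        twoPowOrder b (critDiff d m z k) ^ ArithmeticFunction.moebius (n / k) =
        if n = p then 2 else 1 := by
      rw [← prod_ite_dvd_zpow_moebius two_ne_zero p hn]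
      exact Finset.prod_congr rfl fun k hk => by
        rw [twoPowOrder_critDiff_of_eq_zero hd hm hz1 hb (hdp hk)]
    have h2 : ∏ k ∈ n.divisors,
        twoPowOrder b (critOrbit ℂ d k) ^ (-ArithmeticFunction.moebius (n / k)) =
        (if n = p then 2 else 1)⁻¹ := by
      rw [← prod_ite_dvd_zpow_moebius two_ne_zero p hn, ← Finset.prod_inv_distrib]
      exact Finset.prod_congr rfl fun k hk => by
        rw [twoPowOrder_critOrbit hd (hdp hk), zpow_neg]
    rw [moebiusProd, h1, h2]
    by_cases hnp : n = p
    -- Here `n = p` divides `m - 1`, so the correction factor is present exactly when it is needed.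
    · rw [if_pos hnp, if_pos (hnp ▸ hdvd)]
      norm_num
    · simp [hnp]
  · have h2 : (if n ∣ m - 1 then ∏ k ∈ n.divisors,
        twoPowOrder b (critOrbit ℂ d k) ^ (-ArithmeticFunction.moebius (n / k)) else 1) = 1 := by
      split_ifs with h
      · refine Finset.prod_eq_one fun k hk => ?_
        rw [twoPowOrder_eq_one, one_zpow]
        rw [eval_critOrbit_eq_zero_iff] at hb
        rw [Ne, eval_critOrbit_eq_zero_iff]
        exact fun h' => hb ((h'.trans (Nat.dvd_of_mem_divisors hk)).trans h)
      · rfl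
    rw [moebiusProd, h2, mul_one]
    have hiff := fun (k : ℕ) (hk : 0 < k) => eval_critDiff_eq_zero_iff (b := b) hm hz hk
    set p := Function.minimalPeriod (fun w => w ^ d + b) (z * (critOrbit ℂ d (m - 1)).eval b)
    -- The value `p = 0` encodes a point that is not periodic.
    rcases Nat.eq_zero_or_pos p with hp | hp
    · left
      refine Finset.prod_eq_one fun k hk => ?_
      rw [twoPowOrder_eq_one, one_zpow]
      rw [Ne, hiff k (hdp hk), hp, zero_dvd_iff]
      exact (hdp hk).ne'
    · have hp0 := (hiff p hp).2 dvd_rfl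
      have hr := one_lt_twoPowOrder (critDiff_monic hd hm z hp).ne_zero hp0
      have h1 : ∏ k ∈ n.divisors,
          twoPowOrder b (critDiff d m z k) ^ ArithmeticFunction.moebius (n / k) =
          if n = p then twoPowOrder b (critDiff d m z p) else 1 := by
        rw [← prod_ite_dvd_zpow_moebius (by positivity) p hn]
        refine Finset.prod_congr rfl fun k hk => ?_
        split_ifs with h
        · obtain ⟨q, rfl⟩ := h
          rw [twoPowOrder_critDiff_mul hd hm hz hp hp0 (Nat.pos_of_mul_pos_left (hdp hk))]
        · rw [twoPowOrder_eq_one (mt (hiff k (hdp hk)).1 h)]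
      rw [h1]
      by_cases hnp : n = p
      · right
        rw [if_pos hnp, hnp]
        exact ⟨hr, hb, hiff⟩
      · left
        rw [if_neg hnp]

end Order

/-! ### The Möbius product is a monic polynomial. -/

section Polynomiality

/-- A multiplicative map nonzero on nonzero polynomials extends to rational functions, so orders and
leading coefficients can be read off factor by factor. -/
lemma map_num_misiurewiczRatFunc {F Γ : Type*} [Field F] [CommGroupWithZero Γ] (χ : F[X] →*₀ Γ)
    (hχ : ∀ P, P ≠ 0 → χ P ≠ 0) (d m n : ℕ) (z : F) :
    χ (misiurewiczRatFunc d m n z).num =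
      moebiusProd χ d m n z * χ (misiurewiczRatFunc d m n z).denom := by
  have hle : nonZeroDivisors F[X] ≤ (nonZeroDivisors Γ).comap χ := fun P hP =>
    mem_nonZeroDivisors_of_ne_zero (hχ P (nonZeroDivisors.ne_zero hP))
  set ψ := RatFunc.liftMonoidWithZeroHom χ hle
  have hψ : ∀ P : F[X], ψ (algebraMap F[X] (RatFunc F) P) = χ P := fun P => by
    have := RatFunc.liftMonoidWithZeroHom_apply_div χ hle P 1
    simpa using this
  have h1 : ψ (misiurewiczRatFunc d m n z) = moebiusProd χ d m n z := by
    rw [misiurewiczRatFunc, moebiusProd, map_mul, map_prod, apply_ite ψ, map_one, map_prod]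
    simp only [map_zpow₀, hψ, critDiff]
  rw [← h1, ← hψ, ← hψ, ← map_mul]
  congr 1
  nth_rw 2 [← RatFunc.num_div_denom (misiurewiczRatFunc d m n z)]
  rw [div_mul_cancel₀]
  exact RatFunc.algebraMap_ne_zero (RatFunc.denom_ne_zero _)

variable {F : Type*} [Field F] [Algebra F ℂ] {d m n : ℕ} {z : F}

/-- The image of `misiurewicz d m n z` in `ℂ[X]`. -/
noncomputable def complexMisiurewicz (d m n : ℕ) (z : F) : ℂ[X] :=
  (misiurewicz d m n z).map (algebraMap F ℂ)

lemma map_complexMisiurewicz_eq_mul_denom {Γ : Type*} [CommGroupWithZero Γ] (χ : ℂ[X] →*₀ Γ)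
    (hχ : ∀ P, P ≠ 0 → χ P ≠ 0) (d m n : ℕ) (z : F) :
    χ (complexMisiurewicz d m n z) = moebiusProd χ d m n (algebraMap F ℂ z) *
      χ ((misiurewiczRatFunc d m n z).denom.map (algebraMap F ℂ)) := by
  have h := map_num_misiurewiczRatFunc
    (χ.comp (mapRingHom (algebraMap F ℂ)).toMonoidWithZeroHom) (fun P hP => hχ _ (by
      simpa [Polynomial.map_eq_zero] using hP)) d m n z
  have h2 : moebiusProd (χ.comp (mapRingHom (algebraMap F ℂ)).toMonoidWithZeroHom) d m n z =
      moebiusProd χ d m n (algebraMap F ℂ z) := by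
    simp [moebiusProd, map_critDiff, map_critOrbit]
  rw [h2] at h
  exact h

lemma twoPowOrder_ne_zero (b : ℂ) (P : ℂ[X]) (hP : P ≠ 0) : twoPowOrder b P ≠ 0 := by
  rw [twoPowOrder_apply b hP]
  positivity

/-- A complex root of the denominator is not a root of the coprime numerator, so it would be a pole,
whereas all orders of the product are nonnegative. -/
lemma denom_misiurewiczRatFunc_eq_one (hd : 2 ≤ d) (hm : 2 ≤ m) (hn : 0 < n) (hz : z ^ d = 1)
    (hz1 : z ≠ 1) : (misiurewiczRatFunc d m n z).denom = 1 := by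
  set R := misiurewiczRatFunc d m n z with hR
  have hz' : algebraMap F ℂ z ^ d = 1 := by rw [← map_pow, hz, map_one]
  have hz1' : algebraMap F ℂ z ≠ 1 := fun h => hz1 ((algebraMap F ℂ).injective (by simpa using h))
  have hD0 : R.denom.map (algebraMap F ℂ) ≠ 0 :=
    (R.monic_denom.map _).ne_zero
  have hdeg : (R.denom.map (algebraMap F ℂ)).degree = 0 := by
    by_contra hne
    obtain ⟨b, hb⟩ := IsAlgClosed.exists_root _ hne
    have h := map_complexMisiurewicz_eq_mul_denom (twoPowOrder b) (twoPowOrder_ne_zero b) d m n z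
    have hcop := R.isCoprime_num_denom.map (mapRingHom (algebraMap F ℂ))
    have hN : (complexMisiurewicz d m n z).eval b ≠ 0 := by
      intro h0
      obtain ⟨s, t, hst⟩ := hcop
      have := congrArg (eval b) hst
      rw [eval_add, eval_mul, eval_mul, coe_mapRingHom, IsRoot.def.1 hb] at this
      simp only [complexMisiurewicz, misiurewicz] at h0
      rw [h0] at this
      simp at this
    rw [twoPowOrder_eq_one hN] at h
    have h1 := one_lt_twoPowOrder hD0 hb
    have h2 : 1 ≤ moebiusProd (twoPowOrder b) d m n (algebraMap F ℂ z) := by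
      rcases moebiusProd_twoPowOrder hd hm hn hz' hz1' b with h' | h'
      exacts [h'.ge, h'.1.le]
    rw [← hR] at h
    nlinarith
  rw [degree_map] at hdeg
  exact R.monic_denom.degree_le_zero_iff_eq_one.1 hdeg.le

lemma map_complexMisiurewicz {Γ : Type*} [CommGroupWithZero Γ] (χ : ℂ[X] →*₀ Γ)
    (hχ : ∀ P, P ≠ 0 → χ P ≠ 0) (hd : 2 ≤ d) (hm : 2 ≤ m) (hn : 0 < n) (hz : z ^ d = 1)
    (hz1 : z ≠ 1) :
    χ (complexMisiurewicz d m n z) = moebiusProd χ d m n (algebraMap F ℂ z) := by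
  rw [map_complexMisiurewicz_eq_mul_denom χ hχ,
    denom_misiurewiczRatFunc_eq_one hd hm hn hz hz1, Polynomial.map_one, map_one, mul_one]

lemma complexMisiurewicz_monic (hd : 2 ≤ d) (hm : 2 ≤ m) (hn : 0 < n) (hz : z ^ d = 1)
    (hz1 : z ≠ 1) : (complexMisiurewicz d m n z).Monic := by
  let χ : ℂ[X] →*₀ ℂ := { leadingCoeffHom with map_zero' := leadingCoeff_zero }
  have h := map_complexMisiurewicz χ (fun P hP => leadingCoeff_ne_zero.2 hP) hd hm hn hz hz1
  have h1 : moebiusProd χ d m n (algebraMap F ℂ z) = 1 := by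
    rw [moebiusProd, Finset.prod_eq_one, one_mul]
    · split_ifs
      · refine Finset.prod_eq_one fun k hk => ?_
        rw [show χ (critOrbit ℂ d k) = 1 from
          critOrbit_monic hd (Nat.pos_of_mem_divisors hk), one_zpow]
      · rfl
    · intro k hk
      rw [show χ (critDiff d m (algebraMap F ℂ z) k) = 1 from
          critDiff_monic hd hm _ (Nat.pos_of_mem_divisors hk), one_zpow]
  exact h.trans h1

lemma critOrbit_ne_zero_and_critDiff_eq_zero_iff (hd : 2 ≤ d) (hm : 2 ≤ m) (hn : 0 < n)
    (hz : z ^ d = 1) (hz1 : z ≠ 1) {b : ℂ} (hb : (complexMisiurewicz d m n z).eval b = 0) :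
    (critOrbit ℂ d (m - 1)).eval b ≠ 0 ∧
      ∀ k, 0 < k → ((critDiff d m (algebraMap F ℂ z) k).eval b = 0 ↔ n ∣ k) := by
  have hz' : algebraMap F ℂ z ^ d = 1 := by rw [← map_pow, hz, map_one]
  have hz1' : algebraMap F ℂ z ≠ 1 := fun h => hz1 ((algebraMap F ℂ).injective (by simpa using h))
  have h := map_complexMisiurewicz (twoPowOrder b) (twoPowOrder_ne_zero b) hd hm hn hz hz1
  have h1 := one_lt_twoPowOrder (complexMisiurewicz_monic hd hm hn hz hz1).ne_zero hb
  rcases moebiusProd_twoPowOrder hd hm hn hz' hz1' b with h' | h'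
  · exact absurd (h.trans h') h1.ne'
  · exact h'.2

end Polynomiality

/-! ### Valuation of the Möbius product at a parameter of smaller period. -/

section Valuation

variable {Γ : Type*} [LinearOrderedCommGroupWithZero Γ] {v : Valuation ℂ Γ}
  {d m n l : ℕ} {b x y : ℂ}

lemma valuation_iterate_sub_le (hv : ∀ x, IsIntegral ℤ x → v x ≤ 1) (hb : IsIntegral ℤ b)
    (hx : IsIntegral ℤ x) (hy : IsIntegral ℤ y) (k : ℕ) :
    v ((fun w => w ^ d + b)^[k] x - (fun w => w ^ d + b)^[k] y) ≤ v (x - y) := by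
  induction k with
  | zero => exact le_rfl
  | succ k ih =>
    refine le_trans ?_ ih
    have hx' := isIntegral_iterate (d := d) hb hx k
    have hy' := isIntegral_iterate (d := d) hb hy k
    rw [Function.iterate_succ_apply', Function.iterate_succ_apply', add_sub_add_right_eq_sub,
      ← (Commute.all _ _).geom_sum₂_mul, map_mul]
    refine mul_le_of_le_one_left' (hv _ ?_)
    exact IsIntegral.sum _ fun i _ => (hx'.pow _).mul (hy'.pow _)

lemma valuation_iterate_mul_sub_le (hv : ∀ x, IsIntegral ℤ x → v x ≤ 1) (hb : IsIntegral ℤ b)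
    (hx : IsIntegral ℤ x) (k s : ℕ) :
    v ((fun w => w ^ d + b)^[k * s] x - x) ≤ v ((fun w => w ^ d + b)^[k] x - x) := by
  induction s with
  | zero => simp
  | succ s ih =>
    rw [← sub_add_sub_cancel _ ((fun w => w ^ d + b)^[k * s] x) x]
    refine v.map_add_le ?_ ih
    rw [mul_add_one, Function.iterate_add_apply]
    exact valuation_iterate_sub_le hv hb (isIntegral_iterate hb hx k) hx _

/-- Iterating does not increase `v`-distance. Since `k.gcd l` divides `k` and is itself a multiple
of `k` modulo the period `l`, each side bounds the other. -/
lemma valuation_iterate_sub_eq_gcd (hv : ∀ x, IsIntegral ℤ x → v x ≤ 1) (hb : IsIntegral ℤ b)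
    (hx : IsIntegral ℤ x) (hl : 0 < l)
    (hp : Function.IsPeriodicPt (fun w => w ^ d + b) l x) (k : ℕ) :
    v ((fun w => w ^ d + b)^[k] x - x) = v ((fun w => w ^ d + b)^[k.gcd l] x - x) := by
  refine le_antisymm ?_ ?_
  · obtain ⟨s, hs⟩ := Nat.gcd_dvd_left k l
    nth_rw 1 [hs]
    exact valuation_iterate_mul_sub_le hv hb hx _ s
  · rcases (Nat.gcd_le_right k hl).lt_or_eq with h | h
    · obtain ⟨s, -, hs⟩ := Nat.exists_mul_mod_eq_gcd h
      rw [← hs, hp.iterate_mod_apply]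
      exact valuation_iterate_mul_sub_le hv hb hx k s
    · rw [h, hp.eq]
      simp

lemma isIntegral_iterateDeriv (hb : IsIntegral ℤ b) (hx : IsIntegral ℤ x) (k : ℕ) :
    IsIntegral ℤ (iterateDeriv d b x k) :=
  IsIntegral.prod _ fun _ _ => (map_natCast (algebraMap ℤ ℂ) d ▸ isIntegral_algebraMap).mul
    ((isIntegral_iterate hb hx _).pow _)

/-- For `n > 1` the constant coefficient of `Φ_n` is 1. -/
lemma valuation_eval_cyclotomic_eq_one (hv : ∀ x, IsIntegral ℤ x → v x ≤ 1)
    (hx : IsIntegral ℤ x) (hx1 : v x < 1) (hn : 1 < n) :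
    v ((cyclotomic n ℂ).eval x) = 1 := by
  have h : (cyclotomic n ℂ).eval x = 1 + aeval x (divX (cyclotomic n ℤ)) * x := by
    rw [← map_cyclotomic n (algebraMap ℤ ℂ), eval_map_algebraMap]
    nth_rw 1 [← divX_mul_X_add (cyclotomic n ℤ)]
    rw [map_add, map_mul, aeval_X, aeval_C, cyclotomic_coeff_zero _ hn, map_one, add_comm]
  rw [h]
  refine v.map_one_add_of_lt ?_
  rw [map_mul]
  exact (mul_le_of_le_one_left'
    (hv _ (adjoin_le_integralClosure hx (aeval_mem_adjoin_singleton ℤ x)))).trans_lt hx1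

lemma valuation_iterateDeriv_lt_one (hv : ∀ x, IsIntegral ℤ x → v x ≤ 1) (hd : 2 ≤ d)
    (hb : IsIntegral ℤ b) (hx : IsIntegral ℤ x) {i : ℕ} (hi : i < l)
    (h : v ((fun w => w ^ d + b)^[i] x) < 1) : v (iterateDeriv d b x l) < 1 := by
  have hdi : IsIntegral ℤ (d : ℂ) := map_natCast (algebraMap ℤ ℂ) d ▸ isIntegral_algebraMap
  rw [iterateDeriv, ← Finset.mul_prod_erase _ _ (Finset.mem_range.2 hi), map_mul, map_mul, map_pow]
  have hpow : v ((fun w => w ^ d + b)^[i] x) ^ (d - 1) < 1 :=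
    pow_lt_one₀ zero_le h (by omega)
  refine (mul_le_of_le_one_right' (hv _ ?_)).trans_lt
    ((mul_le_of_le_one_left' (hv _ hdi)).trans_lt hpow)
  · exact IsIntegral.prod _ fun i _ => hdi.mul ((isIntegral_iterate hb hx _).pow _)

/-- If `v(a_k) < 1`, then also `v(a_{km}) < 1`, and `a_{km}` lies on the cycle of `x`. The
multiplier then has valuation below 1, which forces `v(Φ_n) = 1`. -/
lemma valuation_critOrbit_eq_one (hv : ∀ x, IsIntegral ℤ x → v x ≤ 1) (hd : 2 ≤ d)
    (hb : IsIntegral ℤ b) (hx : IsIntegral ℤ x) (hl : 0 < l)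
    (hp : Function.IsPeriodicPt (fun w => w ^ d + b) l x)
    (hxm : x ^ d + b = (critOrbit ℂ d m).eval b) (hn : 1 < n)
    (hΦ : v ((cyclotomic n ℂ).eval (iterateDeriv d b x l)) < 1) {k : ℕ} (hk : 0 < k) :
    v ((critOrbit ℂ d k).eval b) = 1 := by
  refine le_antisymm (hv _ (isIntegral_eval_critOrbit hb k)) (not_lt.1 fun hlt => hΦ.ne ?_)
  refine valuation_eval_cyclotomic_eq_one hv (isIntegral_iterateDeriv hb hx l) ?_ hn
  have hle : m ≤ k * m := Nat.le_mul_of_pos_left m hk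
  -- As `f(x) = a_m`, the point `a_{km}` is the iterate of `x` of index `km - m + 1`.
  have h1 : (critOrbit ℂ d (k * m)).eval b =
      (fun w => w ^ d + b)^[(k * m - m + 1) % l] x := by
    rw [hp.iterate_mod_apply, Function.iterate_succ_apply, hxm, ← eval_iterate, ← critOrbit_add,
      Nat.add_sub_cancel' hle]
  refine valuation_iterateDeriv_lt_one hv hd hb hx (Nat.mod_lt (k * m - m + 1) hl) ?_
  rw [← h1]
  refine lt_of_le_of_lt ?_ hlt
  rw [eval_critOrbit, eval_critOrbit]
  simpa using valuation_iterate_mul_sub_le (d := d) hv hb isIntegral_zero k m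

/-- The leading coefficient of the expansion of a polynomial at `b`. -/
noncomputable def leadingCoeffAt (b : ℂ) : ℂ[X] →*₀ ℂ where
  toFun P := (taylor b P).trailingCoeff
  map_zero' := by simp
  map_one' := by rw [taylor_one, trailingCoeff, natTrailingDegree_C, coeff_C_zero]
  map_mul' P Q := by rw [taylor_mul, trailingCoeff_mul]

lemma leadingCoeffAt_ne_zero (b : ℂ) (P : ℂ[X]) (hP : P ≠ 0) : leadingCoeffAt b P ≠ 0 :=
  trailingCoeff_nonzero_iff_nonzero.2 ((taylor_eq_zero b P).not.2 hP)

lemma leadingCoeffAt_of_eval_ne_zero {P : ℂ[X]} (h : P.eval b ≠ 0) :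
    leadingCoeffAt b P = P.eval b := by
  change (taylor b P).trailingCoeff = _
  rw [← taylor_coeff_zero] at h ⊢
  have h0 : (taylor b P).natTrailingDegree = 0 :=
    natTrailingDegree_eq_zero_of_constantCoeff_ne_zero h
  rw [trailingCoeff, h0]

lemma valuation_leadingCoeffAt_critDiff (hv : ∀ x, IsIntegral ℤ x → v x ≤ 1) (hd : 2 ≤ d)
    (hm : 2 ≤ m) {z : ℂ} (hz : z ^ d = 1) (hl : 0 < l)
    (hiff : ∀ k, 0 < k → ((critDiff d m z k).eval b = 0 ↔ l ∣ k)) {k : ℕ} (hk : 0 < k) :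
    v (leadingCoeffAt b (critDiff d m z k)) = v (leadingCoeffAt b (critDiff d m z (k.gcd l))) *
      v (if l ∣ k then ∑ i ∈ Finset.range (k / l),
        iterateDeriv d b (z * (critOrbit ℂ d (m - 1)).eval b) l ^ i else 1) := by
  have hl0 := (hiff l hl).2 dvd_rfl
  have hzi := isIntegral_of_pow_eq_one hd hz
  have hb := isIntegral_of_eval_critDiff_eq_zero hd hm hzi hl hl0
  have hx := hzi.mul (isIntegral_eval_critOrbit (d := d) hb (m - 1))
  split_ifs with h
  · obtain ⟨q, rfl⟩ := h
    have hq := Nat.pos_of_mul_pos_left hk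
    obtain ⟨H, hH, hHb⟩ := exists_critDiff_mul_eq hm hz hl hl0 hq
    have hH0 : H.eval b ≠ 0 := hHb ▸ geom_sum_iterateDeriv_ne_zero hd hb hx hl hq
    rw [Nat.gcd_mul_right_left, Nat.mul_div_cancel_left _ hl, hH, map_mul, map_mul,
      leadingCoeffAt_of_eval_ne_zero hH0, hHb]
  · have hg := Nat.gcd_pos_of_pos_left l hk
    have hgl : ¬ l ∣ k.gcd l := fun h' => h (h'.trans (Nat.gcd_dvd_left _ _))
    rw [leadingCoeffAt_of_eval_ne_zero (mt (hiff k hk).1 h),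
      leadingCoeffAt_of_eval_ne_zero (mt (hiff _ hg).1 hgl), map_one, mul_one,
      eval_critDiff hm hz b hk, eval_critDiff hm hz b hg]
    refine valuation_iterate_sub_eq_gcd hv hb hx hl ?_ k
    rw [eval_critDiff hm hz b hl, sub_eq_zero] at hl0
    exact hl0

lemma moebiusProd_leadingCoeffAt (hv : ∀ x, IsIntegral ℤ x → v x ≤ 1) (hd : 2 ≤ d)
    (hm : 2 ≤ m) {z : ℂ} (hz : z ^ d = 1) (hn : 0 < n) (hln : l ∣ n) (hlt : l < n)
    (hiff : ∀ k, 0 < k → ((critDiff d m z k).eval b = 0 ↔ l ∣ k))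
    (hΦ : v ((cyclotomic (n / l) ℂ).eval
      (iterateDeriv d b (z * (critOrbit ℂ d (m - 1)).eval b) l)) < 1) :
    v (moebiusProd (leadingCoeffAt b) d m n z) < 1 := by
  have hl : 0 < l := Nat.pos_of_dvd_of_pos hln hn
  have hl0 := (hiff l hl).2 dvd_rfl
  have hzi := isIntegral_of_pow_eq_one hd hz
  have hb := isIntegral_of_eval_critDiff_eq_zero hd hm hzi hl hl0
  set x := z * (critOrbit ℂ d (m - 1)).eval b with hxdef
  have hx : IsIntegral ℤ x := hzi.mul (isIntegral_eval_critOrbit (d := d) hb (m - 1))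
  have hp : Function.IsPeriodicPt (fun w => w ^ d + b) l x := by
    rw [eval_critDiff hm hz b hl, sub_eq_zero] at hl0
    exact hl0
  have hxm : x ^ d + b = (critOrbit ℂ d m).eval b := by
    obtain ⟨m, rfl⟩ := Nat.exists_eq_add_of_le' (show 1 ≤ m by omega)
    rw [hxdef, mul_pow, hz, one_mul, critOrbit, eval_add, eval_pow, eval_X, Nat.add_sub_cancel]
  have hnl : 1 < n / l := by
    obtain ⟨q, rfl⟩ := hln
    rw [Nat.mul_div_cancel_left _ hl]
    by_contra hq
    have : l * q ≤ l * 1 := Nat.mul_le_mul_left l (by omega)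
    omega
  have h2 : v (if n ∣ m - 1 then ∏ k ∈ n.divisors,
        leadingCoeffAt b (critOrbit ℂ d k) ^ (-ArithmeticFunction.moebius (n / k)) else 1) = 1 := by
    split_ifs
    · rw [map_prod]
      refine Finset.prod_eq_one fun k hk => ?_
      have h := valuation_critOrbit_eq_one hv hd hb hx hl hp hxm hnl hΦ
        (Nat.pos_of_mem_divisors hk)
      have h0 : (critOrbit ℂ d k).eval b ≠ 0 := fun h0 => by simp [h0] at h
      rw [leadingCoeffAt_of_eval_ne_zero h0, map_zpow₀, h, one_zpow]
    · exact map_one v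
  rw [moebiusProd, map_mul, h2, mul_one]
  refine lt_of_eq_of_lt ?_ hΦ
  have h3 := prod_geom_sum_zpow_moebius
    (fun q hq => geom_sum_iterateDeriv_ne_zero hd hb hx hl hq) hn hln hlt
  have h4 := prod_gcd_zpow_moebius_eq_one (g := fun k => v (leadingCoeffAt b (critDiff d m z k)))
    (fun k hk => (map_ne_zero v).2 (leadingCoeffAt_ne_zero b _
      (critDiff_monic hd hm z hk).ne_zero)) hn hl hlt
  rw [← h3, map_prod, map_prod, ← one_mul (Finset.prod n.divisors fun k => v (ite _ _ _ ^ _)),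
    ← h4, ← Finset.prod_mul_distrib]
  refine Finset.prod_congr rfl fun k hk => ?_
  rw [map_zpow₀, map_zpow₀, ← mul_zpow, hxdef, ← valuation_leadingCoeffAt_critDiff hv hd hm hz hl
    hiff (Nat.pos_of_mem_divisors hk)]

end Valuation

/-! ### Passing between values of `G` and distances to its roots. -/

section Roots

variable {F : Type*} [Field F] [Algebra F ℂ] {Γ : Type*} [LinearOrderedCommGroupWithZero Γ]
  {v : Valuation ℂ Γ} {d m n l : ℕ} {z : F}

lemma isIntegral_of_eval_complexMisiurewicz (hd : 2 ≤ d) (hm : 2 ≤ m) (hn : 0 < n)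
    (hz : z ^ d = 1) (hz1 : z ≠ 1) {b : ℂ} (hb : (complexMisiurewicz d m n z).eval b = 0) :
    IsIntegral ℤ b := by
  have hz' : algebraMap F ℂ z ^ d = 1 := by rw [← map_pow, hz, map_one]
  exact isIntegral_of_eval_critDiff_eq_zero hd hm (isIntegral_of_pow_eq_one hd hz') hn
    (((critOrbit_ne_zero_and_critDiff_eq_zero_iff hd hm hn hz hz1 hb).2 n hn).2 dvd_rfl)

lemma eval_complexMisiurewicz (hd : 2 ≤ d) (hm : 2 ≤ m) (hn : 0 < n)
    (hz : z ^ d = 1) (hz1 : z ≠ 1) (b : ℂ) :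
    (complexMisiurewicz d m n z).eval b =
      ((complexMisiurewicz d m n z).roots.map (b - ·)).prod :=
  (IsAlgClosed.splits _).eval_eq_prod_roots_of_monic (complexMisiurewicz_monic hd hm hn hz hz1) b

lemma isIntegral_eval_complexMisiurewicz (hd : 2 ≤ d) (hm : 2 ≤ m) (hn : 0 < n)
    (hz : z ^ d = 1) (hz1 : z ≠ 1) {b : ℂ} (hb : IsIntegral ℤ b) :
    IsIntegral ℤ ((complexMisiurewicz d m n z).eval b) := by
  rw [eval_complexMisiurewicz hd hm hn hz hz1]
  refine IsIntegral.multiset_prod fun w hw => ?_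
  obtain ⟨r, hr, rfl⟩ := Multiset.mem_map.1 hw
  exact hb.sub (isIntegral_of_eval_complexMisiurewicz hd hm hn hz hz1 (isRoot_of_mem_roots hr))

lemma exists_root_valuation_sub_lt_one (hv : ∀ x, IsIntegral ℤ x → v x ≤ 1) (hd : 2 ≤ d)
    (hm : 2 ≤ m) (hn : 0 < n) (hln : l ∣ n) (hlt : l < n) (hz : z ^ d = 1) (hz1 : z ≠ 1) {b : ℂ}
    (hb : (complexMisiurewicz d m l z).eval b = 0)
    (hΦ : v ((cyclotomic (n / l) ℂ).eval (iterateDeriv d b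
      (algebraMap F ℂ z * (critOrbit ℂ d (m - 1)).eval b) l)) < 1) :
    ∃ c, (complexMisiurewicz d m n z).eval c = 0 ∧ v (b - c) < 1 := by
  have hz' : algebraMap F ℂ z ^ d = 1 := by rw [← map_pow, hz, map_one]
  have hl : 0 < l := Nat.pos_of_dvd_of_pos hln hn
  have hlt1 : v ((complexMisiurewicz d m n z).eval b) < 1 := by
    by_cases h0 : (complexMisiurewicz d m n z).eval b = 0
    · rw [h0, map_zero]
      exact zero_lt_one
    · rw [← leadingCoeffAt_of_eval_ne_zero h0,
        map_complexMisiurewicz _ (leadingCoeffAt_ne_zero b) hd hm hn hz hz1]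
      exact moebiusProd_leadingCoeffAt hv hd hm hz' hn hln hlt
        (critOrbit_ne_zero_and_critDiff_eq_zero_iff hd hm hl hz hz1 hb).2 hΦ
  -- If every root were at `v`-distance at least 1 from `b`, so would be the product of the
  -- differences.
  by_contra! hcon
  refine hlt1.not_ge ?_
  rw [eval_complexMisiurewicz hd hm hn hz hz1, map_multiset_prod, Multiset.map_map]
  refine Multiset.one_le_prod fun w hw => ?_
  obtain ⟨r, hr, rfl⟩ := Multiset.mem_map.1 hw
  exact hcon r (isRoot_of_mem_roots hr)

lemma valuation_eval_complexMisiurewicz_lt_one (hv : ∀ x, IsIntegral ℤ x → v x ≤ 1)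
    (hd : 2 ≤ d) (hm : 2 ≤ m) (hn : 0 < n) (hz : z ^ d = 1) (hz1 : z ≠ 1) {b c : ℂ}
    (hb : (complexMisiurewicz d m n z).eval b = 0) (hc : IsIntegral ℤ c) (hbc : v (b - c) < 1) :
    v ((complexMisiurewicz d m n z).eval c) < 1 := by
  have hmem : b ∈ (complexMisiurewicz d m n z).roots :=
    (mem_roots (complexMisiurewicz_monic hd hm hn hz hz1).ne_zero).2 hb
  obtain ⟨s, hs⟩ := Multiset.exists_cons_of_mem hmem
  rw [eval_complexMisiurewicz hd hm hn hz hz1, hs, Multiset.map_cons, Multiset.prod_cons, map_mul]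
  rw [v.map_sub_swap] at hbc
  refine (mul_le_of_le_one_right' (hv _ (IsIntegral.multiset_prod fun w hw => ?_))).trans_lt hbc
  obtain ⟨r, hr, rfl⟩ := Multiset.mem_map.1 hw
  exact hc.sub (isIntegral_of_eval_complexMisiurewicz hd hm hn hz hz1
    (isRoot_of_mem_roots (hs ▸ Multiset.mem_cons_of_mem hr)))

end Roots

/-! ### The analytic multiplier as an algebraic product along the cycle. -/

section Multiplier

lemma hasDerivAt_iterate (d : ℕ) (c y : ℂ) (k : ℕ) :
    HasDerivAt (fun w : ℂ => w ^ d + c)^[k] (iterateDeriv d c y k) y := by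
  induction k with
  | zero => simpa [iterateDeriv] using hasDerivAt_id y
  | succ k ih =>
    rw [Function.iterate_succ', iterateDeriv, Finset.prod_range_succ, mul_comm]
    exact HasDerivAt.comp y ((hasDerivAt_pow d _).add_const c) ih

/-- Moving the base point along the cycle permutes the factors cyclically. -/
lemma iterateDeriv_apply_of_isPeriodicPt {R : Type*} [CommRing R] {d l : ℕ} {c x : R}
    (h : Function.IsPeriodicPt (fun w => w ^ d + c) l x) :
    iterateDeriv d c (x ^ d + c) l = iterateDeriv d c x l := by
  cases l with
  | zero => simp [iterateDeriv]
  | succ l =>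
    have hx : (fun w => w ^ d + c)^[l] (x ^ d + c) = x := h
    rw [iterateDeriv, iterateDeriv, Finset.prod_range_succ, Finset.prod_range_succ', hx]
    rfl

lemma map_iterateDeriv {R S : Type*} [CommRing R] [CommRing S] (g : R →+* S) (d : ℕ) (c x : R)
    (k : ℕ) : g (iterateDeriv d c x k) = iterateDeriv d (g c) (g x) k := by
  have h : ∀ i, g ((fun w => w ^ d + c)^[i] x) = (fun w => w ^ d + g c)^[i] (g x) := fun i =>
    Function.Semiconj.iterate_right (fun w => by simp) i x
  simp only [iterateDeriv, map_prod, map_mul, map_pow, map_natCast, h]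

lemma mul_pow_critOrbit_add {d m : ℕ} (hm : 2 ≤ m) {z b : ℂ} (hz : z ^ d = 1) :
    (z * (critOrbit ℂ d (m - 1)).eval b) ^ d + b = (critOrbit ℂ d m).eval b := by
  obtain ⟨m, rfl⟩ := Nat.exists_eq_add_of_le' (show 1 ≤ m by omega)
  rw [mul_pow, hz, one_mul, critOrbit, eval_add, eval_pow, eval_X, Nat.add_sub_cancel]

lemma cycleMultiplier_eq {d m l : ℕ} (hm : 2 ≤ m) {z b : ℂ} (hz : z ^ d = 1) (hl : 0 < l)
    (hiff : ∀ k, 0 < k → ((critDiff d m z k).eval b = 0 ↔ l ∣ k)) :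
    cycleMultiplier d m b = iterateDeriv d b ((critOrbit ℂ d m).eval b) l ∧
      iterateDeriv d b ((critOrbit ℂ d m).eval b) l =
        iterateDeriv d b (z * (critOrbit ℂ d (m - 1)).eval b) l := by
  have hfx := mul_pow_critOrbit_add hm (b := b) hz
  have hp : Function.minimalPeriod (fun w => w ^ d + b)
      (z * (critOrbit ℂ d (m - 1)).eval b) = l := by
    have hpl := (eval_critDiff_eq_zero_iff hm hz hl).1 ((hiff l hl).2 dvd_rfl)
    have hpos := Nat.pos_of_dvd_of_pos hpl hl
    exact Nat.dvd_antisymm hpl ((hiff _ hpos).1 ((eval_critDiff_eq_zero_iff hm hz hpos).2 dvd_rfl))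
  set x := z * (critOrbit ℂ d (m - 1)).eval b
  have hper : Function.IsPeriodicPt (fun w => w ^ d + b) l x :=
    hp ▸ Function.isPeriodicPt_minimalPeriod _ _
  have hp' : Function.minimalPeriod (fun w => w ^ d + b) ((critOrbit ℂ d m).eval b) = l := by
    rw [← hfx, ← hp]
    exact Function.minimalPeriod_apply (Function.mk_mem_periodicPts hl hper)
  refine ⟨?_, ?_⟩
  · rw [cycleMultiplier, multiplier, ← eval_critOrbit, hp', (hasDerivAt_iterate d b _ l).deriv]
  · rw [← hfx]
    exact iterateDeriv_apply_of_isPeriodicPt hper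

end Multiplier

/-! ### Units, valuation rings of `ℂ` and conjugation. -/

section Units

lemma valuation_le_one_of_isIntegral (V : ValuationSubring ℂ) {x : ℂ} (hx : IsIntegral ℤ x) :
    V.valuation x ≤ 1 := by
  rw [V.valuation_le_one_iff]
  obtain ⟨y, hy⟩ := IsIntegrallyClosed.isIntegral_iff.1 (hx.tower_top (A := V))
  exact hy ▸ y.2

/-- The ring of all algebraic integers is integrally closed in `ℂ`, so some valuation ring contains
it and omits `x⁻¹`. For `x = 0` the trivial valuation suffices. -/
lemma exists_valuation_lt_one {x : ℂ} (hx : x ≠ 0 → ¬ IsIntegral ℤ x⁻¹) :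
    ∃ V : ValuationSubring ℂ, V.valuation x < 1 := by
  by_cases h0 : x = 0
  · exact ⟨⊤, by rw [h0, map_zero]; exact zero_lt_one⟩
  · have hcl : IsIntegrallyClosedIn (integralClosure ℤ ℂ).toSubring ℂ :=
      inferInstanceAs (IsIntegrallyClosedIn (integralClosure ℤ ℂ) ℂ)
    obtain ⟨V, -, hV⟩ := Subring.exists_le_valuationSubring_of_isIntegrallyClosedIn
      (R := (integralClosure ℤ ℂ).toSubring) (hx h0)
    refine ⟨V, ?_⟩
    rw [← V.valuation_le_one_iff, not_le, map_inv₀] at hV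
    exact (one_lt_inv₀ (zero_lt_iff.2 ((_root_.map_ne_zero _).2 h0))).1 hV

lemma isUnit_ringOfIntegers_iff {K : IntermediateField ℚ ℂ} (x : 𝓞 K) :
    IsUnit x ↔ ((x : K) : ℂ) ≠ 0 ∧ IsIntegral ℤ ((x : K) : ℂ)⁻¹ := by
  constructor
  · intro h
    obtain ⟨y, hy⟩ := h.exists_right_inv
    have hy' : ((x : K) : ℂ) * ((y : K) : ℂ) = 1 := by
      have := congrArg (fun t : 𝓞 K => ((t : K) : ℂ)) hy
      simpa using this
    refine ⟨left_ne_zero_of_mul_eq_one hy', ?_⟩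
    rw [inv_eq_of_mul_eq_one_right hy']
    exact (y.2.map (algebraMap K ℂ).toIntAlgHom)
  · rintro ⟨h0, h⟩
    have hK : IsIntegral ℤ (x : K)⁻¹ := by
      rw [← isIntegral_algHom_iff (algebraMap K ℂ).toIntAlgHom (algebraMap K ℂ).injective]
      simpa using h
    refine IsUnit.of_mul_eq_one (⟨(x : K)⁻¹, hK⟩ : 𝓞 K) ?_
    apply NumberField.RingOfIntegers.ext
    have h0' : (x : K) ≠ 0 := fun h => h0 (by simp [h])
    exact mul_inv_cancel₀ h0'

/-- Both values are images of one element of the field `F[X]/(G)` under two embeddings into `ℂ`, and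
embeddings preserve and reflect integrality. -/
lemma isIntegral_inv_aeval_of_irreducible {F : Type*} [Field F] [Algebra F ℂ] {G P : F[X]}
    (hG : Irreducible G) {b c : ℂ} (hb : aeval b G = 0) (hc : aeval c G = 0)
    (h : IsIntegral ℤ (aeval b P)⁻¹) : IsIntegral ℤ (aeval c P)⁻¹ := by
  have : Fact (Irreducible G) := ⟨hG⟩
  let σ : ∀ x : ℂ, aeval x G = 0 → AdjoinRoot G →+* ℂ :=
    fun x hx => AdjoinRoot.lift (algebraMap F ℂ) x hx
  have hσ : ∀ x hx, (σ x hx) (AdjoinRoot.mk G P)⁻¹ = (aeval x P)⁻¹ := fun x hx => by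
    rw [map_inv₀]
    rfl
  rw [← hσ b hb] at h
  rw [← hσ c hc]
  have h1 : IsIntegral ℤ (AdjoinRoot.mk G P)⁻¹ :=
    (isIntegral_algHom_iff (σ b hb).toIntAlgHom (σ b hb).injective).1 h
  exact h1.map (σ c hc).toIntAlgHom

lemma aeval_mem_of_mem {K L : IntermediateField ℚ ℂ} (h : K ≤ L) {c : ℂ} (hc : c ∈ L)
    (P : K[X]) : aeval c P ∈ L := by
  rw [aeval_eq_sum_range]
  refine sum_mem fun i _ => ?_
  rw [Algebra.smul_def]
  exact mul_mem (h (P.coeff i).2) (pow_mem hc i)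

lemma critOrbit_eval_mem {K : IntermediateField ℚ ℂ} {c : ℂ} (hc : c ∈ K) (d k : ℕ) :
    (critOrbit ℂ d k).eval c ∈ K := by
  rw [← map_critOrbit (algebraMap ℚ ℂ), eval_map_algebraMap]
  exact IntermediateField.algebra_adjoin_le_adjoin ℚ _ |>.trans
    (IntermediateField.adjoin_simple_le_iff.2 hc) (aeval_mem_adjoin_singleton ℚ c)

lemma exists_ringOfIntegers_cyclotomic_iterateDeriv {b : ℂ} (hb : IsIntegral ℤ b) (d m l N : ℕ) :
    ∃ x : 𝓞 ℚ⟮b⟯, ((x : ℚ⟮b⟯) : ℂ) = (cyclotomic N ℂ).eval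
      (iterateDeriv d b ((critOrbit ℂ d m).eval b) l) := by
  have hgen : IsIntegral ℤ (IntermediateField.AdjoinSimple.gen ℚ b) := by
    rw [← isIntegral_algHom_iff (algebraMap ℚ⟮b⟯ ℂ).toIntAlgHom (algebraMap ℚ⟮b⟯ ℂ).injective]
    exact hb
  let β : 𝓞 ℚ⟮b⟯ := ⟨IntermediateField.AdjoinSimple.gen ℚ b, hgen⟩
  let g : 𝓞 ℚ⟮b⟯ →+* ℂ := (algebraMap ℚ⟮b⟯ ℂ).comp (algebraMap (𝓞 ℚ⟮b⟯) ℚ⟮b⟯)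
  have hβ : g β = b := rfl
  refine ⟨(cyclotomic N _).eval (iterateDeriv d β ((critOrbit _ d m).eval β) l), ?_⟩
  change g _ = _
  rw [← eval_map_apply, map_cyclotomic, map_iterateDeriv, ← eval_map_apply, map_critOrbit, hβ]

end Units

/-! ### The main theorem. -/

theorem proposition4p4 (d m n ℓ : ℕ) (hd : 2 ≤ d) (hm : 2 ≤ m) (hn : 2 ≤ n)
    (hℓ : ℓ ∣ n) (hℓn : ℓ < n)
    (ζ : ℂ) (hζ : ζ ^ d = 1) (hζ1 : ζ ≠ 1)
    (α₀ : ℂ)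
    (hα₀ : aeval α₀ (misiurewicz d m ℓ (IntermediateField.AdjoinSimple.gen ℚ ζ)) = 0)
    (hirr : Irreducible (misiurewicz d m n (IntermediateField.AdjoinSimple.gen ℚ ζ)))
    (c₀ : ℂ)
    (hc₀ : aeval c₀ (misiurewicz d m n (IntermediateField.AdjoinSimple.gen ℚ ζ)) = 0)
    (hΦ : ∀ x : 𝓞 ℚ⟮α₀⟯,
      ((x : ℚ⟮α₀⟯) : ℂ) = (cyclotomic (n / ℓ) ℂ).eval (cycleMultiplier d m α₀) → ¬ IsUnit x) :
    ∃ y : 𝓞 ℚ⟮c₀⟯,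
      ((y : ℚ⟮c₀⟯) : ℂ) =
          aeval c₀ (misiurewicz d m ℓ (IntermediateField.AdjoinSimple.gen ℚ ζ)) ∧
        ¬ IsUnit y := by
  have hn0 : 0 < n := by omega
  have hl : 0 < ℓ := Nat.pos_of_dvd_of_pos hℓ hn0
  set z := IntermediateField.AdjoinSimple.gen ℚ ζ with hzdef
  have hzζ : algebraMap ℚ⟮ζ⟯ ℂ z = ζ := IntermediateField.AdjoinSimple.algebraMap_gen ℚ ζ
  have hz : z ^ d = 1 := (algebraMap ℚ⟮ζ⟯ ℂ).injective (by rw [map_pow, hzζ, hζ, map_one])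
  have hz1 : z ≠ 1 := fun h => hζ1 (by rw [← hzζ, h, map_one])
  have haeval : ∀ k b, (complexMisiurewicz d m k z).eval b = aeval b (misiurewicz d m k z) :=
    fun k b => eval_map_algebraMap _ b
  rw [← haeval] at hα₀ hc₀ ⊢
  have hαi := isIntegral_of_eval_complexMisiurewicz hd hm hl hz hz1 hα₀
  have hci := isIntegral_of_eval_complexMisiurewicz hd hm hn0 hz hz1 hc₀
  have hα := critOrbit_ne_zero_and_critDiff_eq_zero_iff hd hm hl hz hz1 hα₀
  have hc := critOrbit_ne_zero_and_critDiff_eq_zero_iff hd hm hn0 hz hz1 hc₀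
  rw [hzζ] at hα hc
  obtain ⟨hmult, hderiv⟩ := cycleMultiplier_eq hm hζ hl hα.2
  obtain ⟨V, hV⟩ : ∃ V : ValuationSubring ℂ, V.valuation ((cyclotomic (n / ℓ) ℂ).eval
      (iterateDeriv d α₀ (ζ * (critOrbit ℂ d (m - 1)).eval α₀) ℓ)) < 1 := by
    refine exists_valuation_lt_one fun h0 hint => ?_
    obtain ⟨x, hx⟩ := exists_ringOfIntegers_cyclotomic_iterateDeriv hαi d m ℓ (n / ℓ)
    refine hΦ x (by rw [hx, hmult]) ((isUnit_ringOfIntegers_iff x).2 ?_)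
    rw [hx, hderiv]
    exact ⟨h0, hint⟩
  have hv : ∀ x, IsIntegral ℤ x → V.valuation x ≤ 1 := fun x => valuation_le_one_of_isIntegral V
  obtain ⟨c, hcroot, hαc⟩ := exists_root_valuation_sub_lt_one hv hd hm hn0 hℓ hℓn hz hz1 hα₀
    (by rwa [hzζ])
  have hlt := valuation_eval_complexMisiurewicz_lt_one hv hd hm hl hz hz1 hα₀
    (isIntegral_of_eval_complexMisiurewicz hd hm hn0 hz hz1 hcroot) hαc
  have hc0 : c₀ ∈ ℚ⟮c₀⟯ := IntermediateField.mem_adjoin_simple_self ℚ c₀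
  -- The root condition gives `ζ = a_{m+n-1}(c₀) / a_{m-1}(c₀)`, so the coefficients of `G_ℓ` lie in
  -- `ℚ(c₀)`.
  have hζmem : ζ ∈ ℚ⟮c₀⟯ := by
    have h := (hc.2 n hn0).2 dvd_rfl
    rw [critDiff, eval_sub, eval_mul, eval_C, sub_eq_zero] at h
    rw [← mul_div_cancel_right₀ ζ hc.1, ← h]
    exact div_mem (critOrbit_eval_mem hc0 _ _) (critOrbit_eval_mem hc0 _ _)
  have hmem : (complexMisiurewicz d m ℓ z).eval c₀ ∈ ℚ⟮c₀⟯ := by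
    rw [haeval]
    exact aeval_mem_of_mem (IntermediateField.adjoin_simple_le_iff.2 hζmem) hc0 _
  have hint : IsIntegral ℤ (⟨_, hmem⟩ : ℚ⟮c₀⟯) := by
    rw [← isIntegral_algHom_iff (algebraMap ℚ⟮c₀⟯ ℂ).toIntAlgHom (algebraMap ℚ⟮c₀⟯ ℂ).injective]
    exact isIntegral_eval_complexMisiurewicz hd hm hl hz hz1 hci
  refine ⟨⟨⟨_, hmem⟩, hint⟩, rfl, fun hunit => ?_⟩
  obtain ⟨-, hinv⟩ := (isUnit_ringOfIntegers_iff _).1 hunit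
  change IsIntegral ℤ ((complexMisiurewicz d m ℓ z).eval c₀)⁻¹ at hinv
  rw [haeval] at hinv hcroot hc₀
  -- Conjugating `c₀` to `c` carries integrality of the inverse to the root that is `v`-close to
  -- `α₀`.
  have hinv' := hv _ (isIntegral_inv_aeval_of_irreducible hirr hc₀ hcroot hinv)
  rw [← haeval] at hinv' hcroot
  rw [map_inv₀] at hinv'
  refine hinv'.not_gt ((one_lt_inv₀ (zero_lt_iff.2 ((_root_.map_ne_zero _).2 fun h0 => ?_))).2 hlt)
  -- A common root of `G_n` and `G_ℓ` would give one point both exact periods, so `n ∣ ℓ`.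
  have h1 := (critOrbit_ne_zero_and_critDiff_eq_zero_iff hd hm hn0 hz hz1 hcroot).2 ℓ hl
  have h2 := (critOrbit_ne_zero_and_critDiff_eq_zero_iff hd hm hl hz hz1 h0).2 ℓ hl
  exact absurd (Nat.le_of_dvd hl (h1.1 (h2.2 dvd_rfl))) (not_le.2 hℓn)
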